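/- A school choice problem $P$ consists of finite sets $I$ of students and $S$ of schools, a quota $q_s\ge 1$ for each $s\in S$, a strict preference $\succ_i$ of each student $i$ over $S\cup\{s_\emptyset\}$ ($s_\emptyset$ means being unassigned), and a strict priority order over $I$ for each school. A matching is a map $\mu:I\to S\cup\{s_\emptyset\}$ with $|\mu^{-1}(s)|\le q_s$ for all $s\in S$ that is non-wasteful: no student prefers to her assignment a school that has an empty seat. A matching $\mu$ weakly Pareto-dominates $\nu$ if every student likes $\mu$ at least as much as $\nu$, and Pareto-dominates it if moreover some student strictly prefers $\mu$; a matching is Pareto-efficient if no matching Pareto-dominates it. The matching $\mu$ violates the priority of student $i$ if there are $s\in S$ and a student $j$ with $s\succ_i\mu_i$, $\mu_j=s$, and $i$ having higher priority than $j$ at $s$. Let $\mathrm{DA}(P)$ be the outcome of student-proposing Deferred Acceptance, and $\mathcal M(P)$ the set of matchings that Pareto-dominate $\mathrm{DA}(P)$. A student is unimprovable if she has her $\mathrm{DA}(P)$ assignment in every $\mu\in\mathcal M(P)$. A matching $\mu\in\mathcal M(P)$ is justifiable if every student whose priority it violates is either unimprovable or strictly prefers $\mu_i$ to $\mathrm{DA}_i(P)$.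 A matching $\mu$ is priority-neutral if every matching $\nu$ that makes better off (than $\mu$) some student whose priority is violated by $\mu$ violates the priority of some student whom it makes worse off (than $\mu$); it is priority-efficient if it is priority-neutral and Pareto-efficient. A matching $\nu$ blocks $\mu$ if some student $i$ prefers $\nu_i=s\in S$ to $\mu_i$ and has higher priority at $s$ than at least one student assigned to $s$ under $\mu$. A set $L$ of matchings is legal if every matching outside $L$ is blocked by some matching in $L$ and no matching in $L$ blocks a matching in $L$; a matching is legal if it belongs to a legal set. A student-optimal element of a set of matchings is one that weakly Pareto-dominates all elements of the set. Then: (1) There is a problem $P$ with a student-optimal priority-efficient matching that lies in $\mathcal M(P)$ and is not justifiable. (2) There is a problem $P$ with exactly one legal set and a student-optimal legal matching that lies in $\mathcal M(P)$ and is not justifiable. (3) There is a problem $P$ with exactly one matching $\mu$ that is both Pareto-efficient and justifiable, and with exactly one legal set, such that $\mu$ is neither legal nor priority-neutral (and hence not priority-efficient). -/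

import Mathlib

/-- A many-to-one school choice problem with student set `I` and school set `S`. The outside option
(being unassigned) is `none : Option S`. The strict preference of a student and the strict priority
order of a school are given by their rank bijections (lower rank is better). -/
structure SchoolChoiceProblem (I S : Type) [Fintype I] [Fintype S] where
  /-- number of seats of a school -/
  quota : S → ℕ
  quota_pos : ∀ s, 0 < quota s
  /-- rank of each school, and of being unassigned, in the preference of a student -/
  studentRank : I → Option S ≃ Fin (Fintype.card S + 1)
  /-- rank of each student in the priority order of a school -/
  schoolRank : S → I ≃ Fin (Fintype.card I)

namespace SchoolChoiceProblem

variable {I S : Type} [Fintype I] [Fintype S] [DecidableEq S] (P : SchoolChoiceProblem I S)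

/-- Student `i` strictly prefers `a` to `b`. -/
def Prefers (i : I) (a b : Option S) : Prop := P.studentRank i a < P.studentRank i b

instance (i : I) (a b : Option S) : Decidable (P.Prefers i a b) := by
  unfold Prefers; infer_instance

/-- The quotas are respected, and the assignment is non-wasteful: no student prefers a school with
an empty seat to her own assignment. -/
def IsMatching (μ : I → Option S) : Prop :=
  (∀ s : S, (Finset.univ.filter fun i => μ i = some s).card ≤ P.quota s) ∧
    ∀ s : S, (Finset.univ.filter fun i => μ i = some s).card < P.quota s →
      ∀ i : I, ¬ P.Prefers i (some s) (μ i)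

/-- Every student is at least as well off under `μ` as under `ν`. -/
def WeaklyDominates (μ ν : I → Option S) : Prop :=
  ∀ i, P.studentRank i (μ i) ≤ P.studentRank i (ν i)

/-- `μ` Pareto-dominates `ν`. -/
def Dominates (μ ν : I → Option S) : Prop :=
  P.WeaklyDominates μ ν ∧ ∃ i, P.Prefers i (μ i) (ν i)

/-- `μ` is a Pareto-efficient matching. -/
def IsParetoEfficient (μ : I → Option S) : Prop :=
  P.IsMatching μ ∧ ∀ ν, P.IsMatching ν → ¬ P.Dominates ν μ

/-- Student `j` violates the priority of student `i` under `μ`. -/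
def Violates (μ : I → Option S) (j i : I) : Prop :=
  ∃ s : S, P.Prefers i (some s) (μ i) ∧ μ j = some s ∧ P.schoolRank s i < P.schoolRank s j

/-- `μ` violates the priority of student `i`. -/
def ViolatesPriorityOf (μ : I → Option S) (i : I) : Prop := ∃ j, P.Violates μ j i

/-! ### Student-proposing Deferred Acceptance -/

/-- The option to which student `i` currently applies (or where she is tentatively held), if `pos i`
is her current position in her preference list. -/
def applied (pos : I → Fin (Fintype.card S + 1)) (i : I) : Option S :=
  (P.studentRank i).symm (pos i)

/-- Student `i` is rejected in the current round: she applies to, or is held by, a school all of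
whose seats go to current applicants (or held students) with higher priority. -/
def Rejected (pos : I → Fin (Fintype.card S + 1)) (i : I) : Prop :=
  ∃ s : S, P.applied pos i = some s ∧
    P.quota s ≤ (Finset.univ.filter fun j =>
      P.applied pos j = some s ∧ P.schoolRank s j < P.schoolRank s i).card

instance (pos : I → Fin (Fintype.card S + 1)) (i : I) : Decidable (P.Rejected pos i) := by
  unfold Rejected; infer_instance

/-- One round: each rejected student moves to her next option. The sum never wraps around, since
nobody is ever rejected from the outside option, which is on every list. -/
def daRound (pos : I → Fin (Fintype.card S + 1)) : I → Fin (Fintype.card S + 1) :=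
  fun i => if P.Rejected pos i then pos i + 1 else pos i

/-- The Deferred Acceptance matching. Everybody starts at the top of her list. Each round before
termination contains a rejection, and each student is rejected at most once by each school, so the
procedure has terminated (further rounds change nothing) after `|I| * |S|` rounds. -/
def da : I → Option S :=
  P.applied (P.daRound^[Fintype.card I * Fintype.card S] fun _ => 0)

/-! ### Justifiability -/

/-- `μ` is a matching that Pareto-dominates Deferred Acceptance. -/
def ImprovesDA (μ : I → Option S) : Prop := P.IsMatching μ ∧ P.Dominates μ P.da

/-- Student `i` has the same assignment in all improvements upon Deferred Acceptance. -/
def IsUnimprovable (i : I) : Prop := ∀ μ, P.ImprovesDA μ → μ i = P.da i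

/-- Student `i` benefits from `μ` relative to Deferred Acceptance. -/
def IsBeneficiary (μ : I → Option S) (i : I) : Prop := P.Prefers i (μ i) (P.da i)

/-- `μ` improves upon Deferred Acceptance and violates priorities only of unimprovable students and
of beneficiaries. -/
def IsJustifiable (μ : I → Option S) : Prop :=
  P.ImprovesDA μ ∧
    ∀ i, P.ViolatesPriorityOf μ i → P.IsUnimprovable i ∨ P.IsBeneficiary μ i

/-! ### Priority-neutrality, priority-efficiency and legality -/

/-- No matching makes a student whose priority is violated by `μ` better off, unless it violates the
priority of some student whom it makes worse off. -/
def IsPriorityNeutral (μ : I → Option S) : Prop :=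
  P.IsMatching μ ∧ ∀ ν, P.IsMatching ν →
    (∃ i, P.ViolatesPriorityOf μ i ∧ P.Prefers i (ν i) (μ i)) →
      ∃ k, P.ViolatesPriorityOf ν k ∧ P.Prefers k (μ k) (ν k)

/-- Priority-neutral and Pareto-efficient. -/
def IsPriorityEfficient (μ : I → Option S) : Prop :=
  P.IsPriorityNeutral μ ∧ P.IsParetoEfficient μ

/-- `ν` blocks `μ`: some student prefers her school under `ν` to her assignment under `μ` and has
higher priority there than at least one student assigned there under `μ`. -/
def Blocks (ν μ : I → Option S) : Prop :=
  ∃ (i : I) (s : S), ν i = some s ∧ P.Prefers i (some s) (μ i) ∧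
    ∃ j, μ j = some s ∧ P.schoolRank s i < P.schoolRank s j

/-- `L` is a legal set of matchings. -/
def IsLegalSet (L : Set (I → Option S)) : Prop :=
  (∀ μ ∈ L, P.IsMatching μ) ∧
    (∀ μ, P.IsMatching μ → μ ∉ L → ∃ ν ∈ L, P.Blocks ν μ) ∧
    ∀ ν ∈ L, ∀ μ ∈ L, ¬ P.Blocks ν μ

/-- `μ` belongs to a legal set. -/
def IsLegal (μ : I → Option S) : Prop := ∃ L, P.IsLegalSet L ∧ μ ∈ L

/-- `μ` has the property `C`, and every student finds it at least as good as every matching with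
this property. -/
def IsStudentOptimal (C : (I → Option S) → Prop) (μ : I → Option S) : Prop :=
  C μ ∧ ∀ ν, C ν → P.WeaklyDominates μ ν

end SchoolChoiceProblem

/-!
A single problem proves all three parts. Five students compete for four one-seat schools, everybody
finds every school acceptable, and student `4` is unassigned and unimprovable under Deferred
Acceptance. Write a matching as the list of the schools of students `0`, `1`, `2`, `3`, `4`.

* `deferred` `= (0, 3, 1, 2, -)` is the Deferred Acceptance matching. It has exactly three
  improvements.
* `interim` `= (0, 3, 2, 1, -)` arises from it when students `2` and `3` swap seats.
* `adjusted` `= (0, 1, 2, 3, -)` arises from `interim` when students `1` and `3` swap seats.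
* `rival` `= (3, 1, 2, 0, -)` arises from `deferred` by one trading cycle through all of students
  `0`, `1`, `2`, `3`.

The legal matchings are `deferred`, `interim` and `adjusted`: nothing blocks `deferred`, whatever
blocks one of the other two is itself blocked by a preceding one, and each matching besides these
three is blocked by one of them. Likewise each matching besides `adjusted` either is dominated by one
of these three or fails to be priority-neutral because of one of them, so `adjusted` is the only
priority-efficient matching. But `adjusted` violates the priority of student `0` at school `3`. She
keeps her school `0` under `adjusted`, and `rival` would improve her, so `adjusted` is not
justifiable.

The matching `rival` violates only the priorities of student `3`, who benefits, and of student `4`,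
who is unimprovable, so it is justifiable; being efficient, unlike `interim`, it is the only efficient
justifiable matching. Yet the legal matching `interim` blocks it: student `3` prefers school `1`, where
she has priority over student `1`. The same matching refutes priority-neutrality, since it violates
only the priority of student `4`, who is unassigned either way.

Every matching of the problem is a bijection onto the schools and the outside option
(`isMatching_iff_injective`). This makes statements about all matchings decidable by running through
the 120 bijections; `decide +kernel` leaves the long runs to the kernel.
-/

namespace SchoolChoiceProblem

section LegalSets

variable {I S : Type} [Fintype I] [Fintype S] {P : SchoolChoiceProblem I S}

/-- A matching belongs to every legal set that blocks all of its blockers. -/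
theorem IsLegalSet.mem_of_blocks [DecidableEq S] {L : Set (I → Option S)} {μ : I → Option S}
    (hL : P.IsLegalSet L) (hμ : P.IsMatching μ)
    (h : ∀ ν, P.IsMatching ν → P.Blocks ν μ → ∃ ρ ∈ L, P.Blocks ρ ν) : μ ∈ L := by
  by_contra hmem
  obtain ⟨ν, hν, hνμ⟩ := hL.2.1 μ hμ hmem
  obtain ⟨ρ, hρ, hρν⟩ := h ν (hL.1 ν hν) hνμ
  exact hL.2.2 ρ hρ ν hν hρν

/-- No legal set properly contains another one. -/
theorem IsLegalSet.eq_of_subset [DecidableEq S] {K L : Set (I → Option S)}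
    (hK : P.IsLegalSet K) (hL : P.IsLegalSet L) (hKL : K ⊆ L) : L = K := by
  refine Set.Subset.antisymm (fun μ hμ => ?_) hKL
  by_contra hmem
  obtain ⟨ν, hν, hνμ⟩ := hK.2.1 μ (hL.1 μ hμ) hmem
  exact hL.2.2 ν (hKL hν) μ hμ hνμ

end LegalSets

namespace CompetingCycles

/-! ### The problem -/

/-- The priority orders: `toFun` lists the ranks of the students, `invFun` lists the students from
the highest priority to the lowest. -/
def priority (s : Fin 4) : Fin 5 ≃ Fin 5 where
  toFun := ![![2, 0, 1, 3, 4], ![3, 2, 0, 1, 4], ![1, 0, 4, 2, 3], ![1, 0, 2, 4, 3]] s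
  invFun := ![![1, 2, 0, 3, 4], ![2, 3, 1, 0, 4], ![1, 0, 3, 4, 2], ![1, 0, 2, 4, 3]] s
  left_inv := by revert s; decide +kernel
  right_inv := by revert s; decide +kernel

/-- The preferences: `toFun` lists the ranks of the schools, `invFun` lists the options from the best
to the worst, which is always to be unassigned. -/
def preference (i : Fin 5) : Option (Fin 4) ≃ Fin 5 where
  toFun a := a.elim 4
    (![![1, 2, 3, 0], ![2, 0, 3, 1], ![3, 1, 0, 2], ![2, 1, 3, 0], ![3, 0, 2, 1]] i)
  invFun := ![![some 3, some 0, some 1, some 2, none], ![some 1, some 3, some 0, some 2, none],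
    ![some 2, some 1, some 3, some 0, none], ![some 3, some 1, some 0, some 2, none],
    ![some 1, some 3, some 2, some 0, none]] i
  left_inv := by revert i; decide +kernel
  right_inv := by revert i; decide +kernel

/-- The school choice problem with these preferences and priorities, and with one seat per school. -/
def problem : SchoolChoiceProblem (Fin 5) (Fin 4) where
  quota _ := 1
  quota_pos _ := one_pos
  studentRank := preference
  schoolRank := priority

/-- The Deferred Acceptance matching, by `da_eq_deferred`. -/
def deferred : Fin 5 → Option (Fin 4) := ![some 0, some 3, some 1, some 2, none]

/-- The matching in which students `2` and `3` swap their Deferred Acceptance seats. -/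
def interim : Fin 5 → Option (Fin 4) := ![some 0, some 3, some 2, some 1, none]

/-- The matching in which, starting from `interim`, students `1` and `3` swap seats. -/
def adjusted : Fin 5 → Option (Fin 4) := ![some 0, some 1, some 2, some 3, none]

/-- The matching in which students `0`, `1`, `2` and `3` trade their Deferred Acceptance seats along
one cycle. -/
def rival : Fin 5 → Option (Fin 4) := ![some 3, some 1, some 2, some 0, none]

/-- The three matchings that form the only legal set. -/
def legalMatchings : List (Fin 5 → Option (Fin 4)) := [deferred, interim, adjusted]

/-! ### Decidability -/

instance (μ ν : Fin 5 → Option (Fin 4)) : Decidable (problem.Dominates μ ν) := by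
  unfold Dominates WeaklyDominates; infer_instance

instance (μ ν : Fin 5 → Option (Fin 4)) : Decidable (problem.Blocks μ ν) := by
  unfold Blocks; infer_instance

instance (μ : Fin 5 → Option (Fin 4)) (i : Fin 5) :
    Decidable (problem.ViolatesPriorityOf μ i) := by
  unfold ViolatesPriorityOf Violates; infer_instance

theorem injective_of_isMatching {μ : Fin 5 → Option (Fin 4)} (hμ : problem.IsMatching μ) :
    Function.Injective μ := by
  have hsome : ∀ {i j s}, μ i = some s → μ j = some s → i = j := fun {i j s} hi hj =>
    Finset.card_le_one.1 (hμ.1 s) i (by simp [hi]) j (by simp [hj])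
  -- Four seats do not suffice for five students.
  obtain ⟨i₀, hi₀⟩ : ∃ i, μ i = none := by
    by_contra! h
    choose f hf using fun i => Option.ne_none_iff_exists'.1 (h i)
    have hinj : Function.Injective f := fun i j hij => hsome (hf i) (by rw [hij]; exact hf j)
    simpa using Fintype.card_le_of_injective f hinj
  have hsurj : Function.Surjective μ := by
    rintro (_ | s)
    · exact ⟨i₀, hi₀⟩
    · -- An unassigned student would take any free seat.
      by_contra! h
      refine hμ.2 s ?_ i₀ ?_
      · simp [h, problem]
      · rw [hi₀]
        clear h hi₀
        revert s i₀
        decide +kernel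
  exact ((Fintype.bijective_iff_surjective_and_card μ).2 ⟨hsurj, rfl⟩).injective

theorem isMatching_iff_injective {μ : Fin 5 → Option (Fin 4)} :
    problem.IsMatching μ ↔ Function.Injective μ := by
  refine ⟨injective_of_isMatching, fun hμ => ?_⟩
  have hcard : ∀ s : Fin 4, (Finset.univ.filter fun i => μ i = some s).card = 1 := by
    intro s
    obtain ⟨i, hi⟩ := ((Fintype.bijective_iff_injective_and_card μ).2 ⟨hμ, rfl⟩).surjective (some s)
    refine Finset.card_eq_one.2 ⟨i, ?_⟩
    ext j
    simp [← hi, hμ.eq_iff]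
  exact ⟨fun s => (hcard s).le, fun s hs => absurd (hcard s) hs.ne⟩

/-- The quantifier over matchings as nested quantifiers over the assignments of the five students,
with repetitions discarded as soon as they occur. -/
theorem forall_isMatching_iff {Q : (Fin 5 → Option (Fin 4)) → Prop} :
    (∀ μ, problem.IsMatching μ → Q μ) ↔
      ∀ a b, b ≠ a → ∀ c, c ≠ a ∧ c ≠ b → ∀ d, d ≠ a ∧ d ≠ b ∧ d ≠ c →
        ∀ e, e ≠ a ∧ e ≠ b ∧ e ≠ c ∧ e ≠ d → Q ![a, b, c, d, e] := by
  constructor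
  · rintro h a b hb c ⟨_, _⟩ d ⟨_, _, _⟩ e ⟨_, _, _, _⟩
    refine h _ (isMatching_iff_injective.2 fun i j hij => ?_)
    fin_cases i <;> fin_cases j <;> simp_all
  · intro h μ hμ
    have hne : ∀ {i j}, i ≠ j → μ i ≠ μ j := fun hij => (injective_of_isMatching hμ).ne hij
    have := h (μ 0) (μ 1) (hne (by decide)) (μ 2) ⟨hne (by decide), hne (by decide)⟩
      (μ 3) ⟨hne (by decide), hne (by decide), hne (by decide)⟩
      (μ 4) ⟨hne (by decide), hne (by decide), hne (by decide), hne (by decide)⟩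
    convert this using 1
    ext i
    fin_cases i <;> rfl

instance (Q : (Fin 5 → Option (Fin 4)) → Prop) [DecidablePred Q] :
    Decidable (∀ μ, problem.IsMatching μ → Q μ) :=
  decidable_of_iff' _ forall_isMatching_iff

/-! ### Deferred Acceptance and its improvements -/

theorem da_eq_deferred : problem.da = deferred := by decide +kernel

theorem improvesDA_iff {μ : Fin 5 → Option (Fin 4)} :
    problem.ImprovesDA μ ↔ problem.IsMatching μ ∧ problem.Dominates μ deferred := by
  rw [ImprovesDA, da_eq_deferred]

theorem improvesDA_interim : problem.ImprovesDA interim :=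
  improvesDA_iff.2 ⟨isMatching_iff_injective.2 (by decide), by decide⟩

theorem improvesDA_adjusted : problem.ImprovesDA adjusted :=
  improvesDA_iff.2 ⟨isMatching_iff_injective.2 (by decide), by decide⟩

theorem improvesDA_rival : problem.ImprovesDA rival :=
  improvesDA_iff.2 ⟨isMatching_iff_injective.2 (by decide), by decide⟩

theorem eq_of_improvesDA {μ : Fin 5 → Option (Fin 4)} (hμ : problem.ImprovesDA μ) :
    μ = interim ∨ μ = adjusted ∨ μ = rival := by
  have key : ∀ μ, problem.IsMatching μ → problem.Dominates μ deferred →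
      μ = interim ∨ μ = adjusted ∨ μ = rival := by
    decide +kernel
  rw [improvesDA_iff] at hμ
  exact key μ hμ.1 hμ.2

theorem isParetoEfficient_adjusted : problem.IsParetoEfficient adjusted :=
  ⟨improvesDA_adjusted.1, by decide⟩

theorem isParetoEfficient_rival : problem.IsParetoEfficient rival :=
  ⟨improvesDA_rival.1, by decide⟩

/-! ### Justifiability -/

theorem not_isJustifiable_adjusted : ¬ problem.IsJustifiable adjusted := by
  intro h
  have hviol : problem.ViolatesPriorityOf adjusted 0 := by decide +kernel
  rcases h.2 0 hviol with hun | hben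
  · have := hun rival improvesDA_rival
    rw [da_eq_deferred] at this
    revert this
    decide +kernel
  · rw [IsBeneficiary, da_eq_deferred] at hben
    revert hben
    decide +kernel

theorem isUnimprovable_four : problem.IsUnimprovable 4 := by
  intro μ hμ
  rw [da_eq_deferred]
  rcases eq_of_improvesDA hμ with rfl | rfl | rfl <;> rfl

theorem isJustifiable_rival : problem.IsJustifiable rival := by
  refine ⟨improvesDA_rival, fun i hi => ?_⟩
  have key : ∀ i, problem.ViolatesPriorityOf rival i →
      i = 4 ∨ problem.Prefers i (rival i) (deferred i) := by
    decide +kernel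
  rcases key i hi with rfl | h
  · exact Or.inl isUnimprovable_four
  · right
    rwa [IsBeneficiary, da_eq_deferred]

theorem eq_rival_of_isParetoEfficient_of_isJustifiable {ν : Fin 5 → Option (Fin 4)}
    (heff : problem.IsParetoEfficient ν) (hjust : problem.IsJustifiable ν) : ν = rival := by
  rcases eq_of_improvesDA hjust.1 with rfl | rfl | rfl
  · exact absurd (by decide) (heff.2 adjusted improvesDA_adjusted.1)
  · exact absurd hjust not_isJustifiable_adjusted
  · rfl

/-! ### Legality -/

theorem isMatching_of_mem_legalMatchings :
    ∀ μ ∈ legalMatchings, problem.IsMatching μ := by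
  simp only [isMatching_iff_injective]
  decide +kernel

theorem isLegalSet_legalMatchings : problem.IsLegalSet {μ | μ ∈ legalMatchings} := by
  refine ⟨isMatching_of_mem_legalMatchings, ?_, ?_⟩
  · change ∀ μ, problem.IsMatching μ → μ ∉ legalMatchings →
      ∃ ν ∈ legalMatchings, problem.Blocks ν μ
    decide +kernel
  · simp only [Set.mem_ofPred_eq, legalMatchings, List.forall_mem_cons, List.not_mem_nil,
      IsEmpty.forall_iff, implies_true, and_true]
    decide +kernel

theorem legalMatchings_subset {L : Set (Fin 5 → Option (Fin 4))} (hL : problem.IsLegalSet L) :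
    {μ | μ ∈ legalMatchings} ⊆ L := by
  have not_blocks_deferred : ∀ ν, problem.IsMatching ν → ¬ problem.Blocks ν deferred := by
    decide +kernel
  have blocked_of_blocks_interim : ∀ ν, problem.IsMatching ν → problem.Blocks ν interim →
      problem.Blocks deferred ν := by
    decide +kernel
  have blocked_of_blocks_adjusted : ∀ ν, problem.IsMatching ν → problem.Blocks ν adjusted →
      problem.Blocks deferred ν ∨ problem.Blocks interim ν := by
    decide +kernel
  have matching := isMatching_of_mem_legalMatchings
  simp only [legalMatchings, List.forall_mem_cons] at matching
  obtain ⟨hdm, him, ham, -⟩ := matching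
  have hd : deferred ∈ L :=
    hL.mem_of_blocks hdm fun ν hν h => absurd h (not_blocks_deferred ν hν)
  have hi : interim ∈ L :=
    hL.mem_of_blocks him fun ν hν h => ⟨_, hd, blocked_of_blocks_interim ν hν h⟩
  have ha : adjusted ∈ L :=
    hL.mem_of_blocks ham fun ν hν h => (blocked_of_blocks_adjusted ν hν h).elim
      (fun h => ⟨_, hd, h⟩) fun h => ⟨_, hi, h⟩
  intro μ hμ
  simp only [legalMatchings, Set.mem_ofPred_eq, List.mem_cons, List.not_mem_nil, or_false] at hμ
  rcases hμ with rfl | rfl | rfl <;> assumption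

theorem eq_legalMatchings {L : Set (Fin 5 → Option (Fin 4))} (hL : problem.IsLegalSet L) :
    L = {μ | μ ∈ legalMatchings} :=
  isLegalSet_legalMatchings.eq_of_subset hL (legalMatchings_subset hL)

theorem existsUnique_isLegalSet : ∃! L, problem.IsLegalSet L :=
  ⟨_, isLegalSet_legalMatchings, fun _ => eq_legalMatchings⟩

theorem isLegal_iff {μ : Fin 5 → Option (Fin 4)} : problem.IsLegal μ ↔ μ ∈ legalMatchings := by
  refine ⟨?_, fun h => ⟨_, isLegalSet_legalMatchings, h⟩⟩
  rintro ⟨L, hL, hμ⟩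
  rwa [eq_legalMatchings hL] at hμ

theorem isStudentOptimal_isLegal_adjusted :
    problem.IsStudentOptimal problem.IsLegal adjusted := by
  refine ⟨isLegal_iff.2 (by decide), fun ν hν => ?_⟩
  rw [isLegal_iff] at hν
  revert ν
  unfold WeaklyDominates
  decide +kernel

/-! ### Priority-efficiency -/

theorem isPriorityEfficient_adjusted : problem.IsPriorityEfficient adjusted :=
  ⟨⟨improvesDA_adjusted.1, by decide⟩, isParetoEfficient_adjusted⟩

theorem eq_adjusted_of_isPriorityEfficient {ν : Fin 5 → Option (Fin 4)}
    (hν : problem.IsPriorityEfficient ν) : ν = adjusted := by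
  have key : ∀ ν, problem.IsMatching ν → ν ≠ adjusted → ∃ ρ ∈ legalMatchings,
      problem.Dominates ρ ν ∨
        (∃ i, problem.ViolatesPriorityOf ν i ∧ problem.Prefers i (ρ i) (ν i)) ∧
          ¬ ∃ k, problem.ViolatesPriorityOf ρ k ∧ problem.Prefers k (ν k) (ρ k) := by
    decide +kernel
  by_contra hne
  obtain ⟨ρ, hρ, h⟩ := key ν hν.1.1 hne
  have hρm := isMatching_of_mem_legalMatchings ρ hρ
  rcases h with hdom | ⟨hbetter, hworse⟩
  · exact hν.2.2 ρ hρm hdom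
  · exact hworse (hν.1.2 ρ hρm hbetter)

theorem not_isPriorityNeutral_rival : ¬ problem.IsPriorityNeutral rival := by
  intro h
  have := h.2 interim improvesDA_interim.1 ⟨3, by decide, by decide⟩
  revert this
  decide +kernel

end CompetingCycles

end SchoolChoiceProblem

open SchoolChoiceProblem CompetingCycles in
theorem corollary1 :
    -- the student-optimal priority-efficient assignment need not be justifiable
    (∃ (n m : ℕ) (P : SchoolChoiceProblem (Fin n) (Fin m)) (μ : Fin n → Option (Fin m)),
      P.IsStudentOptimal P.IsPriorityEfficient μ ∧ P.ImprovesDA μ ∧ ¬ P.IsJustifiable μ) ∧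
    -- the student-optimal legal assignment need not be justifiable
    (∃ (n m : ℕ) (P : SchoolChoiceProblem (Fin n) (Fin m)) (μ : Fin n → Option (Fin m)),
      (∃! L, P.IsLegalSet L) ∧
      P.IsStudentOptimal P.IsLegal μ ∧ P.ImprovesDA μ ∧ ¬ P.IsJustifiable μ) ∧
    -- the unique Pareto-efficient justifiable matching can be neither legal nor priority-neutral
    (∃ (n m : ℕ) (P : SchoolChoiceProblem (Fin n) (Fin m)) (μ : Fin n → Option (Fin m)),
      (P.IsParetoEfficient μ ∧ P.IsJustifiable μ) ∧
      (∀ ν, P.IsParetoEfficient ν ∧ P.IsJustifiable ν → ν = μ) ∧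
      (∃! L, P.IsLegalSet L) ∧ ¬ P.IsLegal μ ∧
      ¬ P.IsPriorityNeutral μ ∧ ¬ P.IsPriorityEfficient μ) := by
  refine ⟨⟨5, 4, problem, adjusted, ?_, improvesDA_adjusted, not_isJustifiable_adjusted⟩,
    ⟨5, 4, problem, adjusted, existsUnique_isLegalSet, isStudentOptimal_isLegal_adjusted,
      improvesDA_adjusted, not_isJustifiable_adjusted⟩,
    ⟨5, 4, problem, rival, ⟨isParetoEfficient_rival, isJustifiable_rival⟩,
      fun ν hν => eq_rival_of_isParetoEfficient_of_isJustifiable hν.1 hν.2,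
      existsUnique_isLegalSet, fun h => absurd (isLegal_iff.1 h) (by decide),
      not_isPriorityNeutral_rival, fun h => not_isPriorityNeutral_rival h.1⟩⟩
  refine ⟨isPriorityEfficient_adjusted, fun ν hν i => ?_⟩
  rw [eq_adjusted_of_isPriorityEfficient hν]
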